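/- Let $\mathcal X,\mathcal Z$ be standard Borel spaces, $\sim$ an equivalence relation on $\mathcal X$, $X$ an $\mathcal X$-valued random variable, $k\ge 1$ and $0<B<\infty$. Let $\mathcal T$ be the set of all $\mathbb R^k$-valued random variables $Y$, jointly distributed with $X$, whose conditional law satisfies $x\sim x'\Rightarrow P(Y\mid x)=P(Y\mid x')$ and for which $\mathbb E\|Y\|^2\le B^2$. For random variables $Y\in\mathbb R^k$ and $A$ write $R(Y\mid A)=\inf_\varphi \mathbb E\|Y-\varphi(A)\|^2$ (infimum over measurable $\varphi$). For a representation $Z$ of $X$, given by an encoder $P(Z\mid X)$ from $\mathcal X$ to $\mathcal Z$ (so $Z$ is conditionally independent of each task $Y$ given $X$), let $$D(X,Z)=\sup_{Y\in\mathcal T}\bigl(R(Y\mid Z)-R(Y\mid X)\bigr),\qquad Rate(\delta)=\inf_{P(Z\mid X):\,D(X,Z)\le\delta} I(X;Z)\in[0,\infty],$$ with $I$ the mutual information in nats. Let $M:\mathcal X\to\mathbb R^k$ be a measurable maximal invariant, i.e. $x\sim x'\iff M(x)=M(x')$, such that $M(X)$ has a density with respect to Lebesgue measure. Let $\delta\ge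 0$. Then: 1. for every homeomorphism $g$ from $M(\mathcal X)$ onto a subset of $\mathbb R^k$ (for example the identity) with $\mathbb E\|g(M(X))\|^2\le B^2$, $$Rate(\delta)\ \ge\ h(g(M(X)))-\tfrac k2\ln(2\pi e\,\delta/k);$$ 2. for every maximum distortion achieving function $f^*$, i.e. every measurable $f^*:\mathbb R^k\to\mathbb R^k$ with $\mathbb E\|f^*(M(X))\|^2\le B^2$ and $R(f^*(M(X))\mid Z_0)=D(X,Z_0)$ for some representation $Z_0$ of $X$ in $\mathcal Z$, $$Rate(\delta)\ \ge\ h(f^*(M(X)))-\tfrac k2\ln(2\pi e\,\delta/k).$$ Here $h\in[-\infty,\infty)$ is differential entropy in nats, with $h=-\infty$ for a random variable without Lebesgue density; for $\delta=0$ the term $-\tfrac k2\ln(2\pi e\delta/k)$ is $+\infty$, and the right-hand side is read as $-\infty$ when $h=-\infty$. -/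

import Mathlib

open MeasureTheory ProbabilityTheory
open scoped ENNReal

namespace RateInvariance

/-- `ℝ^k` with the Euclidean norm. -/
abbrev Vec (k : ℕ) : Type := EuclideanSpace ℝ (Fin k)

/-- A maximal invariant with respect to the equivalence relation `r`: a measurable map whose
level sets are exactly the equivalence classes. -/
structure IsMaximalInvariant {𝒳 𝓜 : Type*} [MeasurableSpace 𝒳] [MeasurableSpace 𝓜]
    (r : Setoid 𝒳) (M : 𝒳 → 𝓜) : Prop where
  measurable : Measurable M
  iff_eq : ∀ x x' : 𝒳, r x x' ↔ M x = M x'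

/-- Bayes risk under squared error: `μ` is the joint law of `(A, Y)`, and the risk is the
infimum of `E ‖Y - φ(A)‖²` over all measurable predictors `φ`. -/
noncomputable def mseRisk {𝒜 : Type*} [MeasurableSpace 𝒜] {k : ℕ}
    (μ : Measure (𝒜 × Vec k)) : ℝ≥0∞ :=
  ⨅ (φ : 𝒜 → Vec k) (_ : Measurable φ), ∫⁻ p, ‖p.2 - φ p.1‖ₑ ^ 2 ∂μ

section

variable {𝒳 𝒵 : Type*} [MeasurableSpace 𝒳] [MeasurableSpace 𝒵] {k : ℕ}

/-- Invariant tasks of interest under squared error, bounded in `L²` by `B`. The source `X` has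
law `P`; a task `Y` jointly distributed with `X` is given by its regular conditional distribution
`x ↦ P(Y | x)`, which has to be constant on equivalence classes, and `E ‖Y‖² ≤ B²`. -/
structure IsInvariantTask (P : Measure 𝒳) (r : Setoid 𝒳) (B : ℝ) (τ : Kernel 𝒳 (Vec k)) :
    Prop where
  isMarkovKernel : IsMarkovKernel τ
  invariant : ∀ x x' : 𝒳, r x x' → τ x = τ x'
  secondMoment_le : ∫⁻ x, ∫⁻ y, ‖y‖ₑ ^ 2 ∂(τ x) ∂P ≤ ENNReal.ofReal (B ^ 2)

/-- Excess risk of predicting the task `Y` (with conditional law `τ`) from the representation `Z`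
(with conditional law `κ`) instead of from `X`. The triple `(X, Z, Y)` is such that `Y` and `Z`
are conditionally independent given `X`. The first term is the risk from `Z`, the second the risk
from `X`; the second never exceeds the first by the data processing inequality, and both are at
most `B²` for the tasks above, so the subtraction in `ℝ≥0∞` is the ordinary one. -/
noncomputable def excessRisk (P : Measure 𝒳) (κ : Kernel 𝒳 𝒵) (τ : Kernel 𝒳 (Vec k)) : ℝ≥0∞ :=
  mseRisk ((κ ×ₖ τ) ∘ₘ P) - mseRisk (P ⊗ₘ τ)

/-- The invariance distortion: the worst-case excess risk over the invariant tasks of interest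
with values in `ℝ^k`. -/
noncomputable def invDistortion (k : ℕ) (P : Measure 𝒳) (r : Setoid 𝒳) (B : ℝ)
    (κ : Kernel 𝒳 𝒵) : ℝ≥0∞ :=
  ⨆ (τ : Kernel 𝒳 (Vec k)) (_ : IsInvariantTask P r B τ), excessRisk P κ τ

/-- Mutual information `I(X; Z)` (in nats) of the source `X ~ P` and the representation `Z`
obtained from `X` through the encoder `κ`. -/
noncomputable def mutualInfo (P : Measure 𝒳) (κ : Kernel 𝒳 𝒵) : ℝ≥0∞ :=
  InformationTheory.klDiv (P ⊗ₘ κ) (P.prod (κ ∘ₘ P))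

/-- The rate-invariance function for squared error: the infimum of `I(X; Z)` over all encoders
`P(Z | X)` into `𝒵` whose invariance distortion is at most `δ` (it is `∞` if there are none). -/
noncomputable def rate (𝒵 : Type*) [MeasurableSpace 𝒵] (k : ℕ) (P : Measure 𝒳) (r : Setoid 𝒳)
    (B δ : ℝ) : ℝ≥0∞ :=
  ⨅ (κ : Kernel 𝒳 𝒵) (_ : IsMarkovKernel κ)
    (_ : invDistortion k P r B κ ≤ ENNReal.ofReal δ), mutualInfo P κ

/-- `f` is a maximum distortion achieving function for the representation `κ`: `f(M(X))` is
bounded in `L²` by `B`, and its Bayes risk when predicted from `Z` equals the invariance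
distortion. -/
structure IsMaxDistortionAchieving (P : Measure 𝒳) (r : Setoid 𝒳) (M : 𝒳 → Vec k) (B : ℝ)
    (κ : Kernel 𝒳 𝒵) (f : Vec k → Vec k) : Prop where
  measurable : Measurable f
  secondMoment_le : ∫⁻ x, ‖f (M x)‖ₑ ^ 2 ∂P ≤ ENNReal.ofReal (B ^ 2)
  achieves : mseRisk ((P ⊗ₘ κ).map (fun p => (p.2, f (M p.1)))) = invDistortion k P r B κ

end

open Classical in
/-- Differential entropy `h = -∫ p ln p` (in nats) of a probability measure with density `p`, as
positive part minus negative part; it is `-∞` if there is no density. If the second moment is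
finite then the positive part is finite, so the difference is never `∞ - ∞`. -/
noncomputable def differentialEntropy {k : ℕ} (μ : Measure (Vec k)) : EReal :=
  if μ ≪ volume then
    ((∫⁻ x, ENNReal.ofReal (Real.negMulLog (μ.rnDeriv volume x).toReal) : ℝ≥0∞) : EReal)
      - ((∫⁻ x, ENNReal.ofReal (-Real.negMulLog (μ.rnDeriv volume x).toReal) : ℝ≥0∞) : EReal)
  else ⊥

/-- `(k / 2) ln (2 π e δ / k)` as an extended real; it is `-∞` at `δ = 0`. -/
noncomputable def gaussianTerm (k : ℕ) (δ : ℝ) : EReal :=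
  (((k : ℝ) / 2 : ℝ) : EReal) *
    ENNReal.log (ENNReal.ofReal (2 * Real.pi * Real.exp 1 * δ / k))

end RateInvariance

namespace RateInvariance

/-! A square integrable invariant function `u(X)` is itself a task, with zero risk from `X`. So
distortion at most `δ` yields, for each `d > δ`, an estimator `φ(Z)` of `u(X)` with mean squared
error below `d`. It remains to show Shannon's bound `h(u(X)) ≤ I(X;Z) + gaussianTerm k d`, let `d ↓
δ` and take the infimum over encoders; both claims are instances, with `u = g ∘ M` and `u = f ∘ M`.
Shannon's bound is obtained without conditional densities. With `p` the density of `u(X)` and `q` a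
Gaussian density of total variance `d`, the function `w = q(u(x) - φ(z)) / p(u(x))` has integral at
most 1 under the product of the marginals, so the Donsker–Varadhan inequality gives `E log w ≤
I(X;Z)`. Expanding `log w` turns this into the bound. -/

/-! ### Extended expectations and the Donsker–Varadhan inequality -/

/-- If `A ≤ R` almost everywhere and `R` is integrable, then the (extended) integral of `A` is at
most the integral of `R`. -/
theorem lintegral_pos_sub_lintegral_neg_le {α : Type*} [MeasurableSpace α] {μ : Measure α}
    {A R : α → ℝ} (hA : Measurable A) (hR : Integrable R μ) (hAR : A ≤ᵐ[μ] R) :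
    ((∫⁻ a, ENNReal.ofReal (A a) ∂μ : ℝ≥0∞) : EReal)
      - ((∫⁻ a, ENNReal.ofReal (-A a) ∂μ : ℝ≥0∞) : EReal) ≤ ((∫ a, R a ∂μ : ℝ) : EReal) := by
  -- In `EReal` even `⊤ - ⊤` is `⊥`, so this case is trivial.
  by_cases hn : ∫⁻ a, ENNReal.ofReal (-A a) ∂μ = ∞
  · simp [hn]
  have hRp : ∫⁻ a, ENNReal.ofReal (R a) ∂μ ≠ ∞ := hR.lintegral_lt_top.ne
  have hRn : ∫⁻ a, ENNReal.ofReal (-R a) ∂μ ≠ ∞ := hR.neg.lintegral_lt_top.ne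
  have hadd : ∫⁻ a, ENNReal.ofReal (A a) ∂μ + ∫⁻ a, ENNReal.ofReal (-R a) ∂μ
      ≤ ∫⁻ a, ENNReal.ofReal (R a) ∂μ + ∫⁻ a, ENNReal.ofReal (-A a) ∂μ := by
    rw [← lintegral_add_left hA.ennreal_ofReal, ← lintegral_add_right _ hA.fun_neg.ennreal_ofReal]
    refine lintegral_mono_ae (hAR.mono fun a ha => ?_)
    rcases le_total 0 (R a) with h | h
    · rw [ENNReal.ofReal_of_nonpos (neg_nonpos.2 h), add_zero]
      exact (ENNReal.ofReal_le_ofReal ha).trans le_self_add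
    · rw [ENNReal.ofReal_of_nonpos (ha.trans h), ENNReal.ofReal_of_nonpos h, zero_add, zero_add]
      exact ENNReal.ofReal_le_ofReal (neg_le_neg ha)
  have hp : ∫⁻ a, ENNReal.ofReal (A a) ∂μ ≠ ∞ :=
    ((le_self_add.trans hadd).trans_lt (ENNReal.add_lt_top.2 ⟨hRp.lt_top, Ne.lt_top hn⟩)).ne
  rw [integral_eq_lintegral_pos_part_sub_lintegral_neg_part hR]
  have h := ENNReal.toReal_mono (ENNReal.add_ne_top.2 ⟨hRp, hn⟩) hadd
  rw [ENNReal.toReal_add hp hRn, ENNReal.toReal_add hRp hn] at h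
  rw [← EReal.coe_ennreal_toReal hp, ← EReal.coe_ennreal_toReal hn, ← EReal.coe_sub,
    EReal.coe_le_coe_iff]
  linarith

/-- Donsker–Varadhan type bound: if `w` is a `ν`-subprobability density which is positive
`μ`-almost everywhere, then the expectation of `log w + S` under `μ` is at most
`klDiv μ ν + ∫ S ∂μ`. -/
theorem lintegral_log_add_le_klDiv_add {α : Type*} [MeasurableSpace α] {μ ν : Measure α}
    [IsProbabilityMeasure μ] [IsProbabilityMeasure ν] (hkl : InformationTheory.klDiv μ ν ≠ ∞)
    {w A S : α → ℝ} (hw : Measurable w) (hpos : ∀ᵐ a ∂μ, 0 < w a)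
    (hw1 : ∫⁻ a, ENNReal.ofReal (w a) ∂ν ≤ 1) (hA : Measurable A) (hS : Integrable S μ)
    (hAS : ∀ᵐ a ∂μ, A a ≤ Real.log (w a) + S a) :
    ((∫⁻ a, ENNReal.ofReal (A a) ∂μ : ℝ≥0∞) : EReal)
      - ((∫⁻ a, ENNReal.ofReal (-A a) ∂μ : ℝ≥0∞) : EReal)
      ≤ (((InformationTheory.klDiv μ ν).toReal + ∫ a, S a ∂μ : ℝ) : EReal) := by
  obtain ⟨hac, hllr⟩ := InformationTheory.klDiv_ne_top_iff.1 hkl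
  set ρ : α → ℝ := fun a => (μ.rnDeriv ν a).toReal with hρ
  have hρm : Measurable ρ := (Measure.measurable_rnDeriv μ ν).ennreal_toReal
  have hρpos : ∀ᵐ a ∂μ, 0 < ρ a := by
    filter_upwards [Measure.rnDeriv_pos hac, hac.ae_le (Measure.rnDeriv_lt_top μ ν)] with a h1 h2
    exact ENNReal.toReal_pos h1.ne' h2.ne
  -- Passing to `ν` cancels `ρ`; where `ρ = 0` the integrand vanishes, hence only `≤`.
  have hratio : ∫⁻ a, ENNReal.ofReal (w a / ρ a) ∂μ ≤ 1 := by
    rw [← lintegral_rnDeriv_mul hac (hw.fun_div hρm).ennreal_ofReal.aemeasurable]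
    refine (lintegral_mono_ae ?_).trans hw1
    filter_upwards [Measure.rnDeriv_lt_top μ ν] with a ha
    rcases eq_or_ne (μ.rnDeriv ν a) 0 with h0 | h0
    · simp [h0]
    · have hp : 0 < ρ a := ENNReal.toReal_pos h0 ha.ne
      rw [← ENNReal.ofReal_toReal ha.ne, ← ENNReal.ofReal_mul hp.le, mul_div_cancel₀ _ hp.ne']
  have hnn : 0 ≤ᵐ[μ] fun a => w a / ρ a := by
    filter_upwards [hpos, hρpos] with a h1 h2 using (div_pos h1 h2).le
  have hint : Integrable (fun a => w a / ρ a) μ := by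
    refine ⟨(hw.div hρm).aestronglyMeasurable, ?_⟩
    rw [hasFiniteIntegral_iff_ofReal hnn]
    exact hratio.trans_lt ENNReal.one_lt_top
  have hint1 : ∫ a, w a / ρ a ∂μ ≤ 1 := by
    rw [integral_eq_lintegral_of_nonneg_ae hnn (hw.div hρm).aestronglyMeasurable]
    exact ENNReal.toReal_le_of_le_ofReal zero_le_one (by simpa using hratio)
  have hL : Integrable (fun a => llr μ ν a + (w a / ρ a - 1)) μ :=
    hllr.add (hint.sub (integrable_const 1))
  have hR : Integrable (fun a => llr μ ν a + (w a / ρ a - 1) + S a) μ := hL.add hS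
  refine (lintegral_pos_sub_lintegral_neg_le hA hR ?_).trans ?_
  · filter_upwards [hpos, hρpos, hAS] with a h1 h2 h3
    -- With `t = w / ρ`, `log t ≤ t - 1` gives `log w ≤ llr + (t - 1)`, and `t - 1` has nonpositive
    -- mean under `μ`.
    have := Real.log_le_sub_one_of_pos (div_pos h1 h2)
    rw [Real.log_div h1.ne' h2.ne'] at this
    have h4 : llr μ ν a = Real.log (ρ a) := rfl
    linarith
  · rw [EReal.coe_le_coe_iff, integral_add hL hS,
      integral_add (g := fun a => w a / ρ a - 1) hllr (hint.sub (integrable_const 1)), integral_sub hint (integrable_const 1),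
      InformationTheory.toReal_klDiv_of_measure_eq hac (by simp)]
    simp only [integral_const, probReal_univ, smul_eq_mul, mul_one]
    linarith

/-! ### Gaussian densities and differential entropy -/

/-- Density of the centred isotropic Gaussian law on `ℝ^k` with covariance `(2 b)⁻¹ • 1`. -/
noncomputable def gaussianDensity (k : ℕ) (b : ℝ) (v : Vec k) : ℝ :=
  Real.exp (-b * ‖v‖ ^ 2) / (Real.pi / b) ^ ((k : ℝ) / 2)

theorem measurable_gaussianDensity (k : ℕ) (b : ℝ) : Measurable (gaussianDensity k b) := by
  unfold gaussianDensity
  fun_prop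

theorem gaussianDensity_pos (k : ℕ) {b : ℝ} (hb : 0 < b) (v : Vec k) :
    0 < gaussianDensity k b v := by
  unfold gaussianDensity
  positivity

theorem log_gaussianDensity (k : ℕ) {b : ℝ} (hb : 0 < b) (v : Vec k) :
    Real.log (gaussianDensity k b v)
      = -b * ‖v‖ ^ 2 - (k : ℝ) / 2 * Real.log (Real.pi / b) := by
  have h : 0 < Real.pi / b := by positivity
  rw [gaussianDensity, Real.log_div (Real.exp_ne_zero _) (Real.rpow_pos_of_pos h _).ne',
    Real.log_exp, Real.log_rpow h]

theorem lintegral_gaussianDensity (k : ℕ) {b : ℝ} (hb : 0 < b) :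
    ∫⁻ v, ENNReal.ofReal (gaussianDensity k b v) = 1 := by
  have h : 0 < (Real.pi / b) ^ ((k : ℝ) / 2) := by positivity
  have hI : ∫ v : Vec k, gaussianDensity k b v = 1 := by
    simp only [gaussianDensity]
    rw [integral_div, GaussianFourier.integral_rexp_neg_mul_sq_norm hb, finrank_euclideanSpace_fin,
      div_self h.ne']
  have hint : Integrable (gaussianDensity k b) := by
    -- A non-integrable function would have integral 0 by convention, not 1.
    by_contra hne
    rw [integral_undef hne] at hI
    exact zero_ne_one hI
  rw [← ofReal_integral_eq_lintegral_ofReal hint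
    (Filter.Eventually.of_forall fun v => (gaussianDensity_pos k hb v).le), hI, ENNReal.ofReal_one]

/-- Differential entropy as the expectation of `-log p`. -/
theorem differentialEntropy_of_ac {k : ℕ} {μ : Measure (Vec k)} [IsProbabilityMeasure μ]
    (h : μ ≪ volume) :
    differentialEntropy μ
      = ((∫⁻ y, ENNReal.ofReal (-Real.log (μ.rnDeriv volume y).toReal) ∂μ : ℝ≥0∞) : EReal)
        - ((∫⁻ y, ENNReal.ofReal (- -Real.log (μ.rnDeriv volume y).toReal) ∂μ : ℝ≥0∞) :
          EReal) := by
  have hm : Measurable fun y => Real.log (μ.rnDeriv volume y).toReal :=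
    (Measure.measurable_rnDeriv μ volume).ennreal_toReal.log
  rw [differentialEntropy, if_pos h, ← lintegral_rnDeriv_mul h hm.fun_neg.ennreal_ofReal.aemeasurable,
    ← lintegral_rnDeriv_mul h hm.fun_neg.fun_neg.ennreal_ofReal.aemeasurable]
  congr 2 <;>
  · refine lintegral_congr_ae ?_
    filter_upwards [Measure.rnDeriv_lt_top μ volume] with y hy
    conv_rhs => rw [← ENNReal.ofReal_toReal hy.ne]
    rw [ENNReal.toReal_ofReal ENNReal.toReal_nonneg, ← ENNReal.ofReal_mul ENNReal.toReal_nonneg]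
    simp [Real.negMulLog]

/-! ### The Shannon lower bound -/

section

variable {𝒳 𝒵 : Type*} [MeasurableSpace 𝒳] [MeasurableSpace 𝒵] {k : ℕ}

/-- The density of `u(X)` cancels, leaving the mass of the shifted Gaussian on the set where that
density is nonzero. -/
theorem lintegral_gaussianDensity_div_rnDeriv_le {P : Measure 𝒳} [IsProbabilityMeasure P]
    {u : 𝒳 → Vec k} (hu : Measurable u) (hac : P.map u ≪ volume) {b : ℝ} (hb : 0 < b)
    (c : Vec k) :
    ∫⁻ x, ENNReal.ofReal
      (gaussianDensity k b (u x - c) / ((P.map u).rnDeriv volume (u x)).toReal) ∂P ≤ 1 := by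
  have : IsProbabilityMeasure (P.map u) := Measure.isProbabilityMeasure_map hu.aemeasurable
  have hq : Measurable fun y : Vec k => gaussianDensity k b (y - c) :=
    (measurable_gaussianDensity k b).comp (measurable_id.sub_const c)
  have hm : Measurable fun y => ENNReal.ofReal
      (gaussianDensity k b (y - c) / ((P.map u).rnDeriv volume y).toReal) :=
    (hq.div (Measure.measurable_rnDeriv _ _).ennreal_toReal).ennreal_ofReal
  rw [← lintegral_map hm hu, ← lintegral_rnDeriv_mul hac hm.aemeasurable]
  calc _ ≤ ∫⁻ y, ENNReal.ofReal (gaussianDensity k b (y - c)) := by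
        refine lintegral_mono_ae ?_
        filter_upwards [Measure.rnDeriv_lt_top (P.map u) volume] with y hy
        rcases eq_or_ne ((P.map u).rnDeriv volume y) 0 with h0 | h0
        · simp [h0]
        · have hp := ENNReal.toReal_pos h0 hy.ne
          conv_lhs => enter [1]; rw [← ENNReal.ofReal_toReal hy.ne]
          rw [← ENNReal.ofReal_mul hp.le, mul_div_cancel₀ _ hp.ne']
    _ = 1 := by
        rw [lintegral_sub_right_eq_self (fun y => ENNReal.ofReal (gaussianDensity k b y)) c,
          lintegral_gaussianDensity k hb]
    _ ≤ 1 := le_rfl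

theorem gaussianTerm_of_pos (hk : 0 < k) {d : ℝ} (hd : 0 < d) :
    gaussianTerm k d
      = (((k : ℝ) / 2 * Real.log (Real.pi / (k / (2 * d))) + k / 2 : ℝ) : EReal) := by
  have hk' : (0 : ℝ) < k := Nat.cast_pos.2 hk
  rw [gaussianTerm, ENNReal.log_ofReal_of_pos (by positivity), ← EReal.coe_mul]
  congr 1
  have h : 2 * Real.pi * Real.exp 1 * d / k = Real.pi / (k / (2 * d)) * Real.exp 1 := by
    field_simp
  rw [h, Real.log_mul (by positivity) (Real.exp_ne_zero _), Real.log_exp]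
  ring

/-- Shannon lower bound for a function `u(X)` of the source which is estimated by `φ(Z)` with mean
squared error at most `d`. -/
theorem differentialEntropy_le_of_estimator {P : Measure 𝒳} [IsProbabilityMeasure P]
    {κ : Kernel 𝒳 𝒵} [IsMarkovKernel κ] (hk : 0 < k) {u : 𝒳 → Vec k} (hu : Measurable u)
    {φ : 𝒵 → Vec k} (hφ : Measurable φ) {d : ℝ} (hd : 0 < d)
    (hmse : ∫⁻ p, ‖u p.1 - φ p.2‖ₑ ^ 2 ∂(P ⊗ₘ κ) ≤ ENNReal.ofReal d)
    (hI : mutualInfo P κ ≠ ∞) :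
    differentialEntropy (P.map u) ≤ gaussianTerm k d + (mutualInfo P κ : EReal) := by
  by_cases hac : P.map u ≪ volume
  swap
  · simp [differentialEntropy, hac]
  have hk' : (0 : ℝ) < k := Nat.cast_pos.2 hk
  have : IsProbabilityMeasure (P.map u) := Measure.isProbabilityMeasure_map hu.aemeasurable
  -- Variance `d / k` per coordinate, so that `b * d = k / 2`.
  set b : ℝ := k / (2 * d) with hbdef
  have hb : 0 < b := by positivity
  set p : Vec k → ℝ := fun y => ((P.map u).rnDeriv volume y).toReal with hp
  have hpm : Measurable p := (Measure.measurable_rnDeriv _ _).ennreal_toReal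
  have hppos : ∀ᵐ y ∂(P.map u), 0 < p y := by
    filter_upwards [Measure.rnDeriv_pos hac,
      hac.ae_le (Measure.rnDeriv_lt_top (P.map u) volume)] with y h1 h2
    exact ENNReal.toReal_pos h1.ne' h2.ne
  have hfst : (P ⊗ₘ κ).map (fun a => u a.1) = P.map u := by
    rw [show (fun a : 𝒳 × 𝒵 => u a.1) = u ∘ Prod.fst from rfl,
      ← Measure.map_map hu measurable_fst]
    congr 1
    exact Measure.fst_compProd P κ
  have hum : Measurable fun a : 𝒳 × 𝒵 => u a.1 := hu.comp measurable_fst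
  have hppos' : ∀ᵐ a ∂(P ⊗ₘ κ), 0 < p (u a.1) := by
    rw [← hfst] at hppos
    exact ae_of_ae_map hum.aemeasurable hppos
  have hem : Measurable fun a : 𝒳 × 𝒵 => u a.1 - φ a.2 := hum.sub (hφ.comp measurable_snd)
  have hsq : ∀ v : Vec k, ENNReal.ofReal (‖v‖ ^ 2) = ‖v‖ₑ ^ 2 := fun v => by
    rw [ENNReal.ofReal_pow (norm_nonneg _), ofReal_norm]
  have hmse' : ∫⁻ a, ENNReal.ofReal (‖u a.1 - φ a.2‖ ^ 2) ∂(P ⊗ₘ κ) ≤ ENNReal.ofReal d := by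
    simpa only [hsq] using hmse
  have hnn : 0 ≤ᵐ[P ⊗ₘ κ] fun a => ‖u a.1 - φ a.2‖ ^ 2 :=
    Filter.Eventually.of_forall fun a => sq_nonneg _
  have hei : Integrable (fun a => ‖u a.1 - φ a.2‖ ^ 2) (P ⊗ₘ κ) := by
    refine ⟨(hem.norm.pow_const 2).aestronglyMeasurable, ?_⟩
    rw [hasFiniteIntegral_iff_ofReal hnn]
    exact hmse'.trans_lt ENNReal.ofReal_lt_top
  have he : ∫ a, ‖u a.1 - φ a.2‖ ^ 2 ∂(P ⊗ₘ κ) ≤ d := by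
    rw [integral_eq_lintegral_of_nonneg_ae hnn (hem.norm.pow_const 2).aestronglyMeasurable]
    exact ENNReal.toReal_le_of_le_ofReal hd.le hmse'
  set C : ℝ := (k : ℝ) / 2 * Real.log (Real.pi / b) with hC
  have hwm : Measurable fun a : 𝒳 × 𝒵 => gaussianDensity k b (u a.1 - φ a.2) / p (u a.1) :=
    ((measurable_gaussianDensity k b).comp hem).div (hpm.comp hum)
  have hkey := lintegral_log_add_le_klDiv_add (μ := P ⊗ₘ κ) (ν := P.prod (κ ∘ₘ P))
    (w := fun a => gaussianDensity k b (u a.1 - φ a.2) / p (u a.1))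
    (A := fun a => -Real.log (p (u a.1))) (S := fun a => b * ‖u a.1 - φ a.2‖ ^ 2 + C) hI hwm
    (hppos'.mono fun a ha => div_pos (gaussianDensity_pos k hb _) ha)
    (by
      -- Under the product law `z` can be frozen, and `φ z` is then a constant shift.
      rw [lintegral_prod_symm _ hwm.ennreal_ofReal.aemeasurable]
      refine (lintegral_mono fun z =>
        lintegral_gaussianDensity_div_rnDeriv_le hu hac hb (φ z)).trans ?_
      simp)
    (hpm.log.neg.comp hum) ((hei.const_mul b).add (integrable_const C))
    (hppos'.mono fun a ha => by
      rw [Real.log_div (gaussianDensity_pos k hb _).ne' ha.ne', log_gaussianDensity k hb]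
      linarith)
  have hlaw : ∀ F : Vec k → ℝ≥0∞, Measurable F →
      ∫⁻ y, F y ∂(P.map u) = ∫⁻ a, F (u a.1) ∂(P ⊗ₘ κ) := fun F hF => by
    rw [← hfst, lintegral_map hF hum]
  rw [differentialEntropy_of_ac hac, hlaw _ hpm.log.fun_neg.ennreal_ofReal,
    hlaw _ hpm.log.fun_neg.fun_neg.ennreal_ofReal]
  refine hkey.trans ?_
  rw [gaussianTerm_of_pos hk hd, ← hbdef, ← hC, ← EReal.coe_ennreal_toReal hI, ← EReal.coe_add,
    EReal.coe_le_coe_iff, integral_add (hei.const_mul b) (integrable_const C), integral_const_mul]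
  have h1 : b * ∫ a, ‖u a.1 - φ a.2‖ ^ 2 ∂(P ⊗ₘ κ) ≤ k / 2 := by
    calc _ ≤ b * d := by gcongr
      _ = k / 2 := by rw [hbdef]; field_simp
  simp only [integral_const, probReal_univ, smul_eq_mul, one_mul]
  rw [mutualInfo]
  linarith

/-! ### Invariant functions as tasks, and the bound on the rate -/

/-- A square integrable invariant function of the source is an invariant task. -/
theorem isInvariantTask_deterministic {P : Measure 𝒳} {r : Setoid 𝒳} {B : ℝ} {u : 𝒳 → Vec k}
    (hu : Measurable u) (hinv : ∀ x x', r x x' → u x = u x')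
    (hB : ∫⁻ x, ‖u x‖ₑ ^ 2 ∂P ≤ ENNReal.ofReal (B ^ 2)) :
    IsInvariantTask P r B (Kernel.deterministic u hu) where
  isMarkovKernel := inferInstance
  invariant x x' h := by
    rw [Kernel.deterministic_apply, Kernel.deterministic_apply, hinv x x' h]
  secondMoment_le := by
    simpa [Kernel.deterministic_apply] using hB

/-- `u` is an exact predictor from `X`, so the subtracted risk is zero. -/
theorem excessRisk_deterministic {P : Measure 𝒳} [IsProbabilityMeasure P] {κ : Kernel 𝒳 𝒵}
    [IsMarkovKernel κ] {u : 𝒳 → Vec k} (hu : Measurable u) :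
    excessRisk P κ (Kernel.deterministic u hu)
      = ⨅ (φ : 𝒵 → Vec k) (_ : Measurable φ), ∫⁻ p, ‖u p.1 - φ p.2‖ₑ ^ 2 ∂(P ⊗ₘ κ) := by
  have h0 : mseRisk (P ⊗ₘ Kernel.deterministic u hu) = 0 := by
    refine le_antisymm ((iInf₂_le u hu).trans ?_) zero_le
    have hm : Measurable fun p : 𝒳 × Vec k => ‖p.2 - u p.1‖ₑ ^ 2 :=
      (measurable_snd.sub (hu.comp measurable_fst)).enorm.pow_const 2
    rw [Measure.lintegral_compProd hm]
    simp [Kernel.deterministic_apply]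
  rw [excessRisk, h0, tsub_zero, mseRisk]
  refine iInf_congr fun φ => iInf_congr fun hφ => ?_
  have hm : Measurable fun p : 𝒵 × Vec k => ‖p.2 - φ p.1‖ₑ ^ 2 :=
    (measurable_snd.sub (hφ.comp measurable_fst)).enorm.pow_const 2
  have hm' : Measurable fun p : 𝒳 × 𝒵 => ‖u p.1 - φ p.2‖ₑ ^ 2 :=
    ((hu.comp measurable_fst).sub (hφ.comp measurable_snd)).enorm.pow_const 2
  rw [Measure.lintegral_bind (Kernel.aemeasurable _) hm.aemeasurable,
    Measure.lintegral_compProd hm']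
  refine lintegral_congr fun x => ?_
  rw [Kernel.lintegral_prod_deterministic hu κ x hm]

/-- This includes `d = 0`, where the value is `⊥`: multiplication in `EReal` is continuous there
because `k / 2` is finite and nonzero. -/
theorem continuous_gaussianTerm (hk : 0 < k) : Continuous (gaussianTerm k) := by
  have hk' : (0 : ℝ) < (k : ℝ) / 2 := by positivity
  refine continuous_iff_continuousAt.2 fun d => ?_
  have hlog : Continuous fun d : ℝ =>
      ENNReal.log (ENNReal.ofReal (2 * Real.pi * Real.exp 1 * d / k)) :=
    ENNReal.continuous_log.comp (ENNReal.continuous_ofReal.comp (by fun_prop))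
  have hpos : (((k : ℝ) / 2 : ℝ) : EReal) ≠ 0 := by exact_mod_cast hk'.ne'
  have hmul : ContinuousAt (fun q : EReal × EReal => q.1 * q.2)
      ((((k : ℝ) / 2 : ℝ) : EReal),
        ENNReal.log (ENNReal.ofReal (2 * Real.pi * Real.exp 1 * d / k))) :=
    EReal.continuousAt_mul (.inl hpos) (.inl hpos) (.inl (EReal.coe_ne_bot _))
      (.inl (EReal.coe_ne_top _))
  exact hmul.comp (f := fun d : ℝ => ((((k : ℝ) / 2 : ℝ) : EReal),
    ENNReal.log (ENNReal.ofReal (2 * Real.pi * Real.exp 1 * d / k))))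
    (continuousAt_const.prodMk hlog.continuousAt)

/-- Every square integrable invariant function of the source yields a Shannon lower bound on the
rate. -/
theorem differentialEntropy_sub_gaussianTerm_le_rate {P : Measure 𝒳} [IsProbabilityMeasure P]
    {r : Setoid 𝒳} (hk : 0 < k) {B δ : ℝ} (hδ : 0 ≤ δ) {u : 𝒳 → Vec k} (hu : Measurable u)
    (hinv : ∀ x x', r x x' → u x = u x')
    (hB : ∫⁻ x, ‖u x‖ₑ ^ 2 ∂P ≤ ENNReal.ofReal (B ^ 2)) :
    differentialEntropy (P.map u) - gaussianTerm k δ ≤ (rate 𝒵 k P r B δ : EReal) := by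
  have key : ∀ κ : Kernel 𝒳 𝒵, IsMarkovKernel κ →
      invDistortion k P r B κ ≤ ENNReal.ofReal δ →
      differentialEntropy (P.map u) - gaussianTerm k δ ≤ (mutualInfo P κ : EReal) := by
    intro κ _ hD
    by_cases hI : mutualInfo P κ = ∞
    · simp [hI]
    have hrisk : excessRisk P κ (Kernel.deterministic u hu) ≤ ENNReal.ofReal δ :=
      (le_iSup₂ (f := fun τ (_ : IsInvariantTask P r B τ) => excessRisk P κ τ) _
        (isInvariantTask_deterministic hu hinv hB)).trans hD
    rw [excessRisk_deterministic hu] at hrisk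
    -- The infimum over `φ` need not be attained and `δ` may be 0, hence the slack `d > δ`.
    have hd : ∀ d, δ < d →
        differentialEntropy (P.map u) ≤ gaussianTerm k d + (mutualInfo P κ : EReal) := by
      intro d hd
      have hdpos : 0 < d := hδ.trans_lt hd
      have hlt := hrisk.trans_lt ((ENNReal.ofReal_lt_ofReal_iff hdpos).2 hd)
      simp only [iInf_lt_iff] at hlt
      obtain ⟨φ, hφ, hlt⟩ := hlt
      exact differentialEntropy_le_of_estimator hk hu hφ hdpos hlt.le hI
    have hlim : Filter.Tendsto (fun d => gaussianTerm k d + (mutualInfo P κ : EReal))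
        (nhdsWithin δ (Set.Ioi δ)) (nhds (gaussianTerm k δ + (mutualInfo P κ : EReal))) := by
      have hadd : ContinuousAt (fun q : EReal × EReal => q.1 + q.2)
          (gaussianTerm k δ, (mutualInfo P κ : EReal)) :=
        EReal.continuousAt_add (.inr (EReal.coe_ennreal_ne_bot _)) (.inr (by simpa using hI))
      exact hadd.tendsto.comp
        (((continuous_gaussianTerm hk).continuousAt.tendsto.mono_left nhdsWithin_le_nhds).prodMk_nhds
          tendsto_const_nhds)
    exact EReal.sub_le_of_le_add'
      (ge_of_tendsto hlim (eventually_mem_nhdsWithin.mono fun d h => hd d h))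
  -- The rate is an infimum in `ℝ≥0∞`, so the possibly negative bound is truncated at 0, which loses
  -- nothing.
  have htop : (differentialEntropy (P.map u) - gaussianTerm k δ).toENNReal
      ≤ rate 𝒵 k P r B δ :=
    le_iInf₂ fun κ hκ => le_iInf fun hD => by
      simpa using EReal.toENNReal_le_toENNReal (key κ hκ hD)
  exact (EReal.coe_toENNReal_eq_max.symm ▸ le_max_right _ _).trans
    (EReal.coe_ennreal_le_coe_ennreal_iff.2 htop)

end

end RateInvariance

open RateInvariance in
theorem mainTheorem7 {𝒳 𝒵 : Type*}
    [MeasurableSpace 𝒳] [StandardBorelSpace 𝒳] [MeasurableSpace 𝒵] [StandardBorelSpace 𝒵]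
    (P : Measure 𝒳) [IsProbabilityMeasure P] (r : Setoid 𝒳)
    {k : ℕ} (hk : 0 < k) (M : 𝒳 → Vec k) (hM : IsMaximalInvariant r M)
    (hdensity : P.map M ≪ volume) (B : ℝ) (hB : 0 < B) (δ : ℝ) (hδ : 0 ≤ δ) :
    (∀ g : Set.range M → Vec k, Topology.IsEmbedding g →
      ∫⁻ x, ‖g (Set.rangeFactorization M x)‖ₑ ^ 2 ∂P ≤ ENNReal.ofReal (B ^ 2) →
      differentialEntropy (P.map (fun x => g (Set.rangeFactorization M x))) - gaussianTerm k δ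
        ≤ (rate 𝒵 k P r B δ : EReal)) ∧
    (∀ κ : Kernel 𝒳 𝒵, IsMarkovKernel κ → ∀ f : Vec k → Vec k,
      IsMaxDistortionAchieving P r M B κ f →
      differentialEntropy (P.map (fun x => f (M x))) - gaussianTerm k δ
        ≤ (rate 𝒵 k P r B δ : EReal)) := by
  have hinv : ∀ x x', r x x' → Set.rangeFactorization M x = Set.rangeFactorization M x' :=
    fun x x' h => Subtype.ext ((hM.iff_eq x x').1 h)
  refine ⟨fun g hg hB => ?_, fun κ _ f hf => ?_⟩
  · exact differentialEntropy_sub_gaussianTerm_le_rate hk hδ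
      (hg.continuous.measurable.comp (hM.measurable.subtype_mk (h := Set.mem_range_self)))
      (fun x x' h => congrArg g (hinv x x' h)) hB
  · exact differentialEntropy_sub_gaussianTerm_le_rate hk hδ (hf.measurable.comp hM.measurable)
      (fun x x' h => congrArg f ((hM.iff_eq x x').1 h)) hf.secondMoment_le
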